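/- A map $f:U\to F$ from an open subset $U$ of a real locally convex space $E$ to a real locally convex space $F$ is called $C^0$ if it is continuous, and $C^{n+1}$ if it is continuous, the directional derivatives $df(x,h)=\lim_{t\to 0}\frac{1}{t}\,(f(x+th)-f(x))$ exist for all $x\in U$ and $h\in E$, and $df:U\times E\to F$ is $C^n$; it is smooth if it is $C^n$ for all $n$. A locally convex Lie group is a group that is also a Hausdorff smooth manifold modelled on a complete Hausdorff real locally convex space, such that multiplication and inversion are smooth. Let $\mathbf{LCLG}$ be the category of locally convex Lie groups and smooth group homomorphisms. For a locally convex Lie group $G$, a locally convex Lie $G$-group is a locally convex Lie group $F$ together with an action of $G$ on $F$ by group automorphisms, $(g,x)\mapsto gx$, that is smooth as a map $G\times F\to F$. For a subset $A$ of a group $K$ let $C_K(A)=\{x\in K: xa=ax\text{ for every }a\in A\}$. **Theorem.** Let $i:H\to G$ be a morphism in $\mathbf{LCLG}$. The following are equivalent: 1. $i$ is an epimorphism in $\mathbf{LCLG}$; 2. $C_K(f(i(H)))=C_K(f(G))$ for every morphism $f:G\to K$ in $\mathbf{LCLG}$; 3. for every locally convex Lie $G$-group $F$ and every $x\in F$ such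 that $hx=x$ for all $h\in i(H)$, one has $gx=x$ for all $g\in G$. -/

import Mathlib

open Set Filter Topology CategoryTheory

universe u v w

/-! ### Smooth maps between locally convex spaces (in the sense of Michal and Bastiani) -/

/-- `y` is the derivative of `f` at `x` in the direction `h`, i.e. the limit of
`(f (x + t h) - f x) / t` for real `t → 0`, `t ≠ 0`. -/
def HasDirDeriv {E : Type u} {F : Type v} [AddCommGroup E] [Module ℝ E]
    [AddCommGroup F] [Module ℝ F] [TopologicalSpace F] (f : E → F) (x h : E) (y : F) : Prop :=
  Tendsto (fun t : ℝ => t⁻¹ • (f (x + t • h) - f x)) (𝓝[≠] 0) (𝓝 y)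

/-- `f` is of class `C^n` on the open set `U`. A `C^0` map is a continuous map; `f` is `C^(n+1)` if
it is continuous, has directional derivatives `df (x, h)` at all points `x` of `U` in all
directions `h`, and the map `df : U × E → F` is `C^n`. -/
def LCContDiffOn : ℕ → ∀ {E : Type u} {F : Type v} [AddCommGroup E] [Module ℝ E]
    [TopologicalSpace E] [AddCommGroup F] [Module ℝ F] [TopologicalSpace F],
    (E → F) → Set E → Prop
  | 0, _, _, _, _, _, _, _, _, f, U => ContinuousOn f U
  | n + 1, E, F, _, _, _, _, _, _, f, U => ContinuousOn f U ∧
      ∃ df : E × E → F, (∀ x ∈ U, ∀ h : E, HasDirDeriv f x h (df (x, h))) ∧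
        LCContDiffOn n df (U ×ˢ (univ : Set E))

/-- `f` is smooth (of class `C^∞`) on the open set `U`. -/
def LCSmoothOn {E : Type u} {F : Type v} [AddCommGroup E] [Module ℝ E]
    [TopologicalSpace E] [AddCommGroup F] [Module ℝ F] [TopologicalSpace F]
    (f : E → F) (U : Set E) : Prop :=
  ∀ n : ℕ, LCContDiffOn n f U

section Calculus

set_option linter.unusedSectionVars false

variable {E : Type u} {F : Type v} {G : Type w}
  [AddCommGroup E] [Module ℝ E] [TopologicalSpace E] [IsTopologicalAddGroup E]
  [ContinuousSMul ℝ E]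
  [AddCommGroup F] [Module ℝ F] [TopologicalSpace F] [IsTopologicalAddGroup F]
  [ContinuousSMul ℝ F]
  [AddCommGroup G] [Module ℝ G] [TopologicalSpace G] [IsTopologicalAddGroup G]
  [ContinuousSMul ℝ G]

theorem eventually_add_smul_mem {U : Set E} (hU : IsOpen U) {x : E} (hx : x ∈ U) (h : E) :
    ∀ᶠ t : ℝ in 𝓝[≠] 0, x + t • h ∈ U := by
  have hc : ContinuousAt (fun t : ℝ => x + t • h) 0 := by fun_prop
  exact (hc.eventually (hU.mem_nhds (by simpa using hx))).filter_mono nhdsWithin_le_nhds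

theorem HasDirDeriv.congr_of_isOpen {f g : E → F} {U : Set E} (hU : IsOpen U) (hfg : EqOn f g U)
    {x h : E} {y : F} (hx : x ∈ U) (hf : HasDirDeriv f x h y) : HasDirDeriv g x h y := by
  refine Tendsto.congr' ?_ hf
  filter_upwards [eventually_add_smul_mem hU hx h] with t ht
  rw [hfg ht, hfg hx]

theorem HasDirDeriv.unique [T2Space F] {f : E → F} {x h : E} {y z : F}
    (hy : HasDirDeriv f x h y) (hz : HasDirDeriv f x h z) : y = z :=
  tendsto_nhds_unique hy hz

theorem LCContDiffOn.continuousOn {n : ℕ} {f : E → F} {U : Set E} (hf : LCContDiffOn n f U) :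
    ContinuousOn f U := by
  cases n with
  | zero => exact hf
  | succ n => exact hf.1

theorem LCContDiffOn.congr {n : ℕ} {f g : E → F} {U : Set E} (hU : IsOpen U) (hfg : EqOn f g U)
    (hf : LCContDiffOn n f U) : LCContDiffOn n g U := by
  cases n with
  | zero => exact ContinuousOn.congr hf hfg.symm
  | succ n =>
    obtain ⟨hc, df, hd, hdf⟩ := hf
    exact ⟨hc.congr hfg.symm, df, fun x hx h => (hd x hx h).congr_of_isOpen hU hfg hx, hdf⟩

theorem LCContDiffOn.mono {n : ℕ} {E : Type u} {F : Type v} [AddCommGroup E] [Module ℝ E]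
    [TopologicalSpace E] [AddCommGroup F] [Module ℝ F] [TopologicalSpace F] {f : E → F}
    {U V : Set E} (hVU : V ⊆ U) (hf : LCContDiffOn n f U) : LCContDiffOn n f V := by
  induction n generalizing E with
  | zero => exact ContinuousOn.mono hf hVU
  | succ n ih =>
    obtain ⟨hc, df, hd, hdf⟩ := hf
    exact ⟨hc.mono hVU, df, fun x hx h => hd x (hVU hx) h,
      ih (prod_mono hVU subset_rfl) hdf⟩

theorem LCContDiffOn.of_succ {n : ℕ} {E : Type u} {F : Type v} [AddCommGroup E] [Module ℝ E]
    [TopologicalSpace E] [AddCommGroup F] [Module ℝ F] [TopologicalSpace F] {f : E → F}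
    {U : Set E} (hf : LCContDiffOn (n + 1) f U) : LCContDiffOn n f U := by
  induction n generalizing E with
  | zero => exact hf.1
  | succ n ih =>
    obtain ⟨hc, df, hd, hdf⟩ := hf
    exact ⟨hc, df, hd, ih hdf⟩

/-- Being `C^n` is a local property. -/
theorem LCContDiffOn.of_locally [T2Space F] {n : ℕ} {f : E → F} {U : Set E} (hU : IsOpen U)
    (hf : ∀ x ∈ U, ∃ V, IsOpen V ∧ x ∈ V ∧ LCContDiffOn n f V) : LCContDiffOn n f U := by
  have hc : ContinuousOn f U := fun x hx => by
    obtain ⟨V, hV, hxV, hfV⟩ := hf x hx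
    exact (hfV.continuousOn.continuousAt (hV.mem_nhds hxV)).continuousWithinAt
  induction n generalizing E with
  | zero => exact hc
  | succ n ih =>
    classical
    choose! V hV hxV hfV using hf
    have hd : ∀ x ∈ U, ∃ df : E × E → F,
        (∀ z ∈ V x, ∀ h : E, HasDirDeriv f z h (df (z, h))) ∧
        LCContDiffOn n df (V x ×ˢ (univ : Set E)) := fun x hx => (hfV x hx).2
    choose! df hdf hdf' using hd
    have hloc : ∀ p ∈ U ×ˢ (univ : Set E), ∃ W, IsOpen W ∧ p ∈ W ∧
        LCContDiffOn n (fun q : E × E => df q.1 q) W := by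
      rintro ⟨x, h⟩ ⟨hx, -⟩
      have ho : IsOpen ((V x ∩ U) ×ˢ (univ : Set E)) := ((hV x hx).inter hU).prod isOpen_univ
      refine ⟨_, ho, ⟨⟨hxV x hx, hx⟩, mem_univ _⟩, ?_⟩
      refine LCContDiffOn.congr ho ?_
        ((hdf' x hx).mono (prod_mono inter_subset_left subset_rfl))
      rintro ⟨z, k⟩ ⟨⟨hz, hzU⟩, -⟩
      exact (hdf x hx z hz k).unique (hdf z hzU z (hxV z hzU) k)
    refine ⟨hc, fun q => df q.1 q, fun x hx h => hdf x hx x (hxV x hx) h,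
      ih (hU.prod isOpen_univ) hloc ?_⟩
    intro p hp
    obtain ⟨W, hW, hpW, hfW⟩ := hloc p hp
    exact (hfW.continuousOn.continuousAt (hW.mem_nhds hpW)).continuousWithinAt

theorem LCContDiffOn.prodMk {n : ℕ} {E : Type u} {F : Type v} {G : Type w}
    [AddCommGroup E] [Module ℝ E] [TopologicalSpace E] [AddCommGroup F] [Module ℝ F]
    [TopologicalSpace F] [AddCommGroup G] [Module ℝ G] [TopologicalSpace G]
    {f : E → F} {g : E → G} {U : Set E}
    (hf : LCContDiffOn n f U) (hg : LCContDiffOn n g U) :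
    LCContDiffOn n (fun x => (f x, g x)) U := by
  induction n generalizing E with
  | zero => exact ContinuousOn.prodMk hf hg
  | succ n ih =>
    obtain ⟨hfc, df, hfd, hdf⟩ := hf
    obtain ⟨hgc, dg, hgd, hdg⟩ := hg
    exact ⟨hfc.prodMk hgc, fun p => (df p, dg p),
      fun x hx h => (hfd x hx h).prodMk_nhds (hgd x hx h), ih hdf hdg⟩

/-- Continuous linear maps are smooth. -/
theorem ContinuousLinearMap.lcContDiffOn {n : ℕ} {E : Type u} {F : Type v}
    [AddCommGroup E] [Module ℝ E] [TopologicalSpace E] [AddCommGroup F] [Module ℝ F]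
    [TopologicalSpace F] (L : E →L[ℝ] F) (U : Set E) : LCContDiffOn n L U := by
  induction n generalizing E with
  | zero => exact L.continuous.continuousOn
  | succ n ih =>
    refine ⟨L.continuous.continuousOn, L.comp (ContinuousLinearMap.snd ℝ E E), ?_, ih _ _⟩
    intro x _ h
    refine tendsto_const_nhds.congr' ?_
    filter_upwards [self_mem_nhdsWithin] with t ht
    have ht : t ≠ 0 := ht
    simp [smul_smul, ht]

/-- Mean value theorem: a difference quotient lies in every closed convex set that contains all
the directional derivatives along the segment. -/
theorem HasDirDeriv.slope_mem [LocallyConvexSpace ℝ F] {g : E → F} {y k : E} {t : ℝ} (ht : t ≠ 0)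
    {d : E → F} {W : Set F} (hWc : IsClosed W) (hW : Convex ℝ W)
    (hd : ∀ s ∈ Icc (0 : ℝ) 1, HasDirDeriv g (y + (s * t) • k) k (d (y + (s * t) • k)) ∧
      d (y + (s * t) • k) ∈ W) :
    t⁻¹ • (g (y + t • k) - g y) ∈ W := by
  by_contra hn
  obtain ⟨l, c, hlc, hcl⟩ := geometric_hahn_banach_closed_point hW hWc hn
  have hder : ∀ s ∈ Icc (0 : ℝ) 1, HasDerivAt (fun s : ℝ => l (g (y + (s * t) • k)))
      (l (d (y + (s * t) • k)) * t) s := by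
    intro s hs
    have h1 : HasDerivAt (fun r : ℝ => l (g (y + r • k))) (l (d (y + (s * t) • k))) (s * t) := by
      rw [hasDerivAt_iff_tendsto_slope_zero]
      refine ((l.continuous.tendsto _).comp (hd s hs).1).congr fun r => ?_
      simp only [Function.comp_apply, map_smul, map_sub, add_smul, add_assoc]
    have h2 : HasDerivAt (fun s : ℝ => s * t) t s := by
      simpa using (hasDerivAt_id s).mul_const t
    exact h1.comp s h2
  obtain ⟨s, hs, hs'⟩ := exists_hasDerivAt_eq_slope (fun s : ℝ => l (g (y + (s * t) • k)))
    (fun s => l (d (y + (s * t) • k)) * t) zero_lt_one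
    (fun s hs => (hder s hs).continuousAt.continuousWithinAt)
    (fun s hs => hder s (Ioo_subset_Icc_self hs))
  have hlt := hlc _ (hd s (Ioo_subset_Icc_self hs)).2
  have heq : l (t⁻¹ • (g (y + t • k) - g y)) = l (d (y + (s * t) • k)) := by
    simp only [one_mul, zero_mul, zero_smul, add_zero, sub_zero, div_one] at hs'
    rw [map_smul, map_sub, ← hs', smul_eq_mul]
    field_simp
  rw [heq] at hcl
  exact lt_asymm hlt hcl

/-- The chain rule for directional derivatives of `C^1` maps. -/
theorem HasDirDeriv.comp [LocallyConvexSpace ℝ G] {f : E → F} {g : F → G} {V : Set F}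
    (hV : IsOpen V) {dg : F × F → G}
    (hg : ∀ y ∈ V, ∀ k : F, HasDirDeriv g y k (dg (y, k)))
    (hdg : ContinuousOn dg (V ×ˢ (univ : Set F)))
    {x h : E} (hx : f x ∈ V) {k : F} (hf : HasDirDeriv f x h k) :
    HasDirDeriv (g ∘ f) x h (dg (f x, k)) := by
  have hcont : ContinuousAt dg (f x, k) :=
    hdg.continuousAt ((hV.prod isOpen_univ).mem_nhds ⟨hx, mem_univ _⟩)
  intro W₀ hW₀
  obtain ⟨C, hC, hCc, hCW⟩ := exists_mem_nhds_isClosed_subset hW₀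
  obtain ⟨B, ⟨hB, hBc⟩, hBC⟩ :=
    (LocallyConvexSpace.convex_basis (𝕜 := ℝ) (dg (f x, k))).mem_iff.1 hC
  have hWsub : closure B ⊆ W₀ := (closure_minimal hBC hCc).trans hCW
  have hWn : closure B ∈ 𝓝 (dg (f x, k)) := mem_of_superset hB subset_closure
  have hgood : ∀ᶠ q : F × F in 𝓝 (f x, k), q.1 ∈ V ∧ dg q ∈ closure B :=
    ((continuous_fst.tendsto (f x, k)).eventually (hV.mem_nhds hx)).and
      (hcont.eventually hWn)
  have hm : Tendsto (fun q : ℝ × F => (f x + q.1 • q.2, q.2)) (𝓝 (0, k)) (𝓝 (f x, k)) := by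
    have : Continuous (fun q : ℝ × F => (f x + q.1 • q.2, q.2)) := by fun_prop
    simpa using this.tendsto (0, k)
  have hev := hm.eventually hgood
  rw [nhds_prod_eq, Filter.eventually_prod_iff] at hev
  obtain ⟨p, hp, p', hp', hpp⟩ := hev
  obtain ⟨ε, hε, hball⟩ := Metric.eventually_nhds_iff.1 hp
  have hsmall : ∀ᶠ t : ℝ in 𝓝[≠] 0, dist t 0 < ε :=
    (Metric.eventually_nhds_iff.2 ⟨ε, hε, fun _ h => h⟩ : ∀ᶠ t : ℝ in 𝓝 0, dist t 0 < ε).filter_mono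
      nhdsWithin_le_nhds
  have hk := hf.eventually hp'
  rw [Filter.mem_map]
  filter_upwards [hsmall, hk, self_mem_nhdsWithin] with t ht htk ht0
  have ht0 : t ≠ 0 := ht0
  apply hWsub
  set kt : F := t⁻¹ • (f (x + t • h) - f x) with hkt
  have hfx : f (x + t • h) = f x + t • kt := by
    rw [hkt, smul_smul, mul_inv_cancel₀ ht0, one_smul]; abel
  have key := HasDirDeriv.slope_mem (g := g) (y := f x) (k := kt) (t := t) ht0
    (d := fun z => dg (z, kt)) isClosed_closure hBc.closure (fun s hs => by
      have hst : p (s * t) := by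
        apply hball
        rw [Real.dist_eq, sub_zero] at ht ⊢
        rw [abs_mul, abs_of_nonneg hs.1]
        exact lt_of_le_of_lt (mul_le_of_le_one_left (abs_nonneg t) hs.2) ht
      have := hpp hst htk
      exact ⟨hg _ this.1 kt, this.2⟩)
  simpa only [mem_preimage, Function.comp_apply, hfx] using key

theorem LCContDiffOn.comp_clm {n : ℕ} {E : Type u} {F : Type v} {G : Type w}
    [AddCommGroup E] [Module ℝ E] [TopologicalSpace E]
    [AddCommGroup F] [Module ℝ F] [TopologicalSpace F]
    [AddCommGroup G] [Module ℝ G] [TopologicalSpace G]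
    {g : F → G} {V : Set F} (hg : LCContDiffOn n g V) (L : E →L[ℝ] F) :
    LCContDiffOn n (fun x => g (L x)) (L ⁻¹' V) := by
  induction n generalizing E F with
  | zero => exact ContinuousOn.comp hg L.continuous.continuousOn (mapsTo_preimage _ _)
  | succ n ih =>
    obtain ⟨hgc, dg, hgd, hdg⟩ := hg
    refine ⟨hgc.comp L.continuous.continuousOn (mapsTo_preimage _ _),
      fun p => dg (L.prodMap L p), fun x hx h => ?_, ?_⟩
    · have h1 : HasDirDeriv g (L x) (L h) (dg (L x, L h)) := hgd (L x) hx (L h)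
      change HasDirDeriv _ x h (dg (L x, L h))
      simpa only [HasDirDeriv, map_add, map_smul] using h1
    · refine (ih hdg (L.prodMap L)).mono fun p hp => ?_
      exact mem_prod.2 ⟨hp.1, mem_univ _⟩

/-- Composites of `C^n` maps are `C^n`. -/
theorem LCContDiffOn.comp {n : ℕ} {E : Type u} {F : Type v} {G : Type w}
    [AddCommGroup E] [Module ℝ E] [TopologicalSpace E] [IsTopologicalAddGroup E]
    [ContinuousSMul ℝ E]
    [AddCommGroup F] [Module ℝ F] [TopologicalSpace F] [IsTopologicalAddGroup F]
    [ContinuousSMul ℝ F]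
    [AddCommGroup G] [Module ℝ G] [TopologicalSpace G] [IsTopologicalAddGroup G]
    [ContinuousSMul ℝ G] [LocallyConvexSpace ℝ G]
    {f : E → F} {g : F → G} {U : Set E} {V : Set F}
    (hU : IsOpen U) (hV : IsOpen V) (hg : LCContDiffOn n g V) (hf : LCContDiffOn n f U)
    (hUV : MapsTo f U V) : LCContDiffOn n (g ∘ f) U := by
  induction n generalizing E F with
  | zero => exact ContinuousOn.comp hg hf hUV
  | succ n ih =>
    have hfn := hf.of_succ
    obtain ⟨hgc, dg, hgd, hdg⟩ := hg
    obtain ⟨hfc, df, hfd, hdf⟩ := hf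
    refine ⟨hgc.comp hfc hUV, dg ∘ fun p : E × E => (f p.1, df p), ?_, ?_⟩
    · intro x hx h
      exact HasDirDeriv.comp hV hgd hdg.continuousOn (hUV hx) (hfd x hx h)
    · refine ih (hU.prod isOpen_univ) (hV.prod isOpen_univ) hdg (LCContDiffOn.prodMk ?_ hdf) ?_
      · exact (hfn.comp_clm (ContinuousLinearMap.fst ℝ E E)).mono fun p hp => hp.1
      · rintro ⟨x, h⟩ ⟨hx, -⟩
        exact ⟨hUV hx, mem_univ _⟩

end Calculus

/-! ### Manifolds modelled on locally convex spaces -/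

/-- The product of two charted spaces is charted by the products of charts, with values in the
product `E × F` of the model spaces. -/
instance prodLCChartedSpace (E : Type*) [TopologicalSpace E] (F : Type*) [TopologicalSpace F]
    (M : Type*) [TopologicalSpace M] [ChartedSpace E M]
    (N : Type*) [TopologicalSpace N] [ChartedSpace F N] : ChartedSpace (E × F) (M × N) where
  atlas := image2 OpenPartialHomeomorph.prod (atlas E M) (atlas F N)
  chartAt p := (chartAt E p.1).prod (chartAt F p.2)
  mem_chart_source p := ⟨mem_chart_source E p.1, mem_chart_source F p.2⟩
  chart_mem_atlas p := mem_image2_of_mem (chart_mem_atlas E p.1) (chart_mem_atlas F p.2)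

/-- All the chart changes of the atlas of `M`, with values in the locally convex space `E`,
are smooth. -/
def IsSmoothAtlas (E : Type u) [AddCommGroup E] [Module ℝ E] [TopologicalSpace E]
    (M : Type v) [TopologicalSpace M] [ChartedSpace E M] : Prop :=
  ∀ e ∈ atlas E M, ∀ e' ∈ atlas E M, LCSmoothOn (e' ∘ e.symm) (e.symm.trans e').source

/-- A map between manifolds modelled on the locally convex spaces `E` and `F` is smooth if it is
continuous and smooth in charts. -/
def IsSmoothMap (E : Type u) [AddCommGroup E] [Module ℝ E] [TopologicalSpace E]
    (F : Type u) [AddCommGroup F] [Module ℝ F] [TopologicalSpace F]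
    {M : Type v} [TopologicalSpace M] [ChartedSpace E M]
    {N : Type w} [TopologicalSpace N] [ChartedSpace F N] (f : M → N) : Prop :=
  Continuous f ∧ ∀ e ∈ atlas E M, ∀ e' ∈ atlas F N,
    LCSmoothOn (e' ∘ f ∘ e.symm) (e.target ∩ e.symm ⁻¹' (f ⁻¹' e'.source))

theorem IsSmoothMap.id (E : Type u) [AddCommGroup E] [Module ℝ E] [TopologicalSpace E]
    {M : Type v} [TopologicalSpace M] [ChartedSpace E M] (h : IsSmoothAtlas E M) :
    IsSmoothMap E E (fun x : M => x) :=
  ⟨continuous_id, fun e he e' he' => h e he e' he'⟩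

theorem IsSmoothMap.comp {E F G : Type u}
    [AddCommGroup E] [Module ℝ E] [TopologicalSpace E] [IsTopologicalAddGroup E]
    [ContinuousSMul ℝ E]
    [AddCommGroup F] [Module ℝ F] [TopologicalSpace F] [IsTopologicalAddGroup F]
    [ContinuousSMul ℝ F]
    [AddCommGroup G] [Module ℝ G] [TopologicalSpace G] [IsTopologicalAddGroup G]
    [ContinuousSMul ℝ G] [LocallyConvexSpace ℝ G] [T2Space G]
    {M N P : Type v} [TopologicalSpace M] [ChartedSpace E M]
    [TopologicalSpace N] [ChartedSpace F N] [TopologicalSpace P] [ChartedSpace G P]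
    {f : M → N} {g : N → P} (hg : IsSmoothMap F G g) (hf : IsSmoothMap E F f) :
    IsSmoothMap E G (fun x => g (f x)) := by
  refine ⟨hg.1.comp hf.1, fun e he e' he' n => ?_⟩
  have hopen : ∀ {s : Set M}, IsOpen s → IsOpen (e.target ∩ e.symm ⁻¹' s) := fun hs =>
    e.symm.isOpen_inter_preimage hs
  refine LCContDiffOn.of_locally
    (hopen (e'.open_source.preimage (hg.1.comp hf.1))) fun x hx => ?_
  set c := chartAt F (f (e.symm x)) with hc
  have hcm : c ∈ atlas F N := chart_mem_atlas F _
  have hxc : f (e.symm x) ∈ c.source := mem_chart_source F _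
  have hcg : IsOpen (c.target ∩ c.symm ⁻¹' (g ⁻¹' e'.source)) :=
    c.symm.isOpen_inter_preimage (e'.open_source.preimage hg.1)
  have ho : IsOpen (e.target ∩ e.symm ⁻¹' (f ⁻¹' (c.source ∩ g ⁻¹' e'.source))) :=
    hopen ((c.open_source.inter (e'.open_source.preimage hg.1)).preimage hf.1)
  refine ⟨_, ho, ⟨hx.1, hxc, hx.2⟩, ?_⟩
  have h1 : LCContDiffOn n (c ∘ f ∘ e.symm)
      (e.target ∩ e.symm ⁻¹' (f ⁻¹' (c.source ∩ g ⁻¹' e'.source))) :=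
    (hf.2 e he c hcm n).mono (inter_subset_inter_right _ fun y hy => hy.1)
  refine LCContDiffOn.congr ho ?_ (LCContDiffOn.comp ho hcg (hg.2 c hcm e' he' n) h1 ?_)
  · intro y hy
    simp [c.left_inv hy.2.1]
  · intro y hy
    refine ⟨c.map_source hy.2.1, ?_⟩
    have hy2 : g (f (e.symm y)) ∈ e'.source := hy.2.2
    simpa [c.left_inv hy.2.1] using hy2

/-! ### The category of locally convex Lie groups -/

/-- A locally convex Lie group: a group that is a Hausdorff smooth manifold modelled on a complete
Hausdorff real locally convex space, with smooth multiplication and inversion. -/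
structure LCLG : Type (u + 1) where
  /-- The underlying set of the group. -/
  carrier : Type u
  /-- The model space. -/
  model : Type u
  [addCommGroup : AddCommGroup model]
  [module : Module ℝ model]
  [uniformSpace : UniformSpace model]
  [isUniformAddGroup : IsUniformAddGroup model]
  [continuousSMul : ContinuousSMul ℝ model]
  [locallyConvexSpace : LocallyConvexSpace ℝ model]
  [t2Space_model : T2Space model]
  [completeSpace : CompleteSpace model]
  [group : Group carrier]
  [topologicalSpace : TopologicalSpace carrier]
  [t2Space : T2Space carrier]
  [chartedSpace : ChartedSpace model carrier]
  isSmoothAtlas : IsSmoothAtlas model carrier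
  smooth_mul : IsSmoothMap (model × model) model (fun p : carrier × carrier => p.1 * p.2)
  smooth_inv : IsSmoothMap model model (fun x : carrier => x⁻¹)

namespace LCLG

instance : CoeSort LCLG.{u} (Type u) := ⟨LCLG.carrier⟩

attribute [instance] addCommGroup module uniformSpace isUniformAddGroup continuousSMul
  locallyConvexSpace t2Space_model completeSpace group topologicalSpace t2Space chartedSpace

/-- Morphisms of locally convex Lie groups: smooth group homomorphisms. -/
structure Hom (G K : LCLG.{u}) extends G →* K where
  smooth : IsSmoothMap G.model K.model toFun

instance (G K : LCLG.{u}) : FunLike (Hom G K) G K where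
  coe f := f.toFun
  coe_injective f g h := by
    cases f; cases g; congr; exact MonoidHom.ext fun x => congrFun h x

instance : Category LCLG.{u} where
  Hom := Hom
  id G := ⟨MonoidHom.id G, IsSmoothMap.id G.model G.isSmoothAtlas⟩
  comp f g := ⟨g.toMonoidHom.comp f.toMonoidHom, g.smooth.comp f.smooth⟩

instance : ConcreteCategory LCLG.{u} Hom where
  hom f := f
  ofHom f := f

end LCLG

/-- The structure of a locally convex Lie `G`-group on `F`: a smooth action `G × F → F` by group
automorphisms of `F`. -/
class LCLG.LieGGroup (G F : LCLG.{u}) extends MulDistribMulAction G F where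
  smooth_smul : IsSmoothMap (G.model × F.model) F.model (fun p : G × F => p.1 • p.2)

/-!
All three conditions say that elements commuting with the image of `H` commute with the image of
`G`, and one passes between them by realizing fixed points and equalizers as centralizers.

If `i` is an epimorphism and `x` centralizes `f(i(H))`, then `f` and its conjugate by `x` agree on
`i(H)`, hence on `G`. If `G` acts on `F`, an element of `F` is fixed by `g` if and only if it commutes
with `g` in the semidirect product `F ⋊ G` (`LCLG.semidirectInr_mul_comm_iff`); so the condition on
centralizers, applied to `G ⟶ F ⋊ G`, gives the condition on fixed points. Conversely, the centralizer
of `f(G)` in `K` is the set of fixed points of the conjugation action of `G` on `K`.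

Finally, two morphisms `f₁, f₂ : G ⟶ K` combine to a morphism from `G` to the wreath product
`(K × K) ⋊ {±1}`, where the interchange of the factors commutes with `(f₁ g, f₂ g)` if and only if
`f₁ g = f₂ g` (`LCLG.wreathLift_mul_comm_iff`). Hence if `f₁` and `f₂` agree on `i(H)`, the condition
on centralizers forces `f₁ = f₂`.

What has to be checked is that these groups are locally convex Lie groups. The wreath product is an
iterated semidirect product, whose smoothness follows from that of projections, pairings and
composites, together with the locality of smoothness for the action of the discrete group `{±1}`.
-/

/-! ### Smooth maps into and out of products -/

theorem LCContDiffOn.const {n : ℕ} {E : Type u} {F : Type v} [AddCommGroup E] [Module ℝ E]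
    [TopologicalSpace E] [AddCommGroup F] [Module ℝ F] [TopologicalSpace F] (c : F) (U : Set E) :
    LCContDiffOn n (fun _ : E => c) U := by
  cases n with
  | zero => exact continuousOn_const
  | succ n =>
    refine ⟨continuousOn_const, (0 : E × E →L[ℝ] F), fun x _ h => ?_,
      ContinuousLinearMap.lcContDiffOn _ _⟩
    simpa [HasDirDeriv] using tendsto_const_nhds

namespace IsSmoothMap

section

variable {E F G : Type u}
  [AddCommGroup E] [Module ℝ E] [TopologicalSpace E]
  [AddCommGroup F] [Module ℝ F] [TopologicalSpace F]
  [AddCommGroup G] [Module ℝ G] [TopologicalSpace G]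
  {M : Type v} [TopologicalSpace M] [ChartedSpace E M]
  {N : Type v} [TopologicalSpace N] [ChartedSpace F N]
  {P : Type v} [TopologicalSpace P] [ChartedSpace G P]

theorem const (c : N) : IsSmoothMap E F (fun _ : M => c) :=
  ⟨continuous_const, fun _ _ e' _ _ => LCContDiffOn.const (e' c) _⟩

/-- A continuous map to a zero-dimensional manifold is smooth. -/
theorem of_subsingleton_model [Subsingleton F] {f : M → N} (hf : Continuous f) :
    IsSmoothMap E F f := by
  refine ⟨hf, fun e _ e' _ n => ?_⟩
  have h : e' ∘ f ∘ e.symm = fun _ => 0 := funext fun _ => Subsingleton.elim _ _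
  exact h ▸ LCContDiffOn.const _ _

theorem fst (hM : IsSmoothAtlas E M) : IsSmoothMap (E × F) E (fun p : M × N => p.1) := by
  refine ⟨continuous_fst, ?_⟩
  rintro _ ⟨e, he, e', -, rfl⟩ e'' he'' n
  refine ((hM e he e'' he'' n).comp_clm (ContinuousLinearMap.fst ℝ E F)).mono ?_
  exact fun p hp => ⟨hp.1.1, hp.2⟩

theorem snd (hN : IsSmoothAtlas F N) : IsSmoothMap (E × F) F (fun p : M × N => p.2) := by
  refine ⟨continuous_snd, ?_⟩
  rintro _ ⟨e, -, e', he', rfl⟩ e'' he'' n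
  refine ((hN e' he' e'' he'' n).comp_clm (ContinuousLinearMap.snd ℝ E F)).mono ?_
  exact fun p hp => ⟨hp.1.2, hp.2⟩

theorem prodMk {f : M → N} {g : M → P} (hf : IsSmoothMap E F f) (hg : IsSmoothMap E G g) :
    IsSmoothMap E (F × G) (fun x => (f x, g x)) := by
  refine ⟨hf.1.prodMk hg.1, ?_⟩
  rintro e he _ ⟨e', he', e'', he'', rfl⟩ n
  exact ((hf.2 e he e' he' n).mono fun _ hx => And.intro hx.1 hx.2.1).prodMk
    ((hg.2 e he e'' he'' n).mono fun _ hx => And.intro hx.1 hx.2.2)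

end

/-- Smoothness is local on the source. -/
theorem of_locally {E F : Type u}
    [AddCommGroup E] [Module ℝ E] [TopologicalSpace E] [IsTopologicalAddGroup E]
    [ContinuousSMul ℝ E]
    [AddCommGroup F] [Module ℝ F] [TopologicalSpace F] [IsTopologicalAddGroup F]
    [ContinuousSMul ℝ F] [T2Space F]
    {M : Type v} [TopologicalSpace M] [ChartedSpace E M]
    {N : Type v} [TopologicalSpace N] [ChartedSpace F N] {f : M → N}
    (h : ∀ x, ∃ V, IsOpen V ∧ x ∈ V ∧ ∃ g : M → N, IsSmoothMap E F g ∧ EqOn g f V) :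
    IsSmoothMap E F f := by
  have hc : Continuous f := continuous_iff_continuousAt.2 fun x => by
    obtain ⟨V, hV, hx, g, hg, hgf⟩ := h x
    exact hg.1.continuousAt.congr (hgf.eventuallyEq_of_mem (hV.mem_nhds hx))
  refine ⟨hc, fun e he e' he' n => LCContDiffOn.of_locally
    (e.symm.isOpen_inter_preimage (e'.open_source.preimage hc)) fun x hx => ?_⟩
  obtain ⟨V, hV, hxV, g, hg, hgf⟩ := h (e.symm x)
  have ho := e.symm.isOpen_inter_preimage (hV.inter (e'.open_source.preimage hg.1))
  refine ⟨_, ho, ⟨hx.1, hxV, ?_⟩, LCContDiffOn.congr ho ?_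
    ((hg.2 e he e' he' n).mono fun _ hy => And.intro hy.1 hy.2.2)⟩
  · simpa only [mem_preimage, hgf hxV] using hx.2
  · exact fun y hy => congrArg e' (hgf hy.2.1)

end IsSmoothMap

theorem IsSmoothAtlas.prod {E F : Type u}
    [AddCommGroup E] [Module ℝ E] [TopologicalSpace E]
    [AddCommGroup F] [Module ℝ F] [TopologicalSpace F]
    {M : Type v} [TopologicalSpace M] [ChartedSpace E M]
    {N : Type v} [TopologicalSpace N] [ChartedSpace F N]
    (hM : IsSmoothAtlas E M) (hN : IsSmoothAtlas F N) : IsSmoothAtlas (E × F) (M × N) :=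
  -- The chart changes are the identity map read in charts.
  ((IsSmoothMap.fst hM).prodMk (IsSmoothMap.snd hN)).2

namespace LCLG

/-! ### Smooth maps between Lie groups -/

section

variable {E : Type u} [AddCommGroup E] [Module ℝ E] [TopologicalSpace E]
  [IsTopologicalAddGroup E] [ContinuousSMul ℝ E]
  {M : Type u} [TopologicalSpace M] [ChartedSpace E M]

theorem isSmoothMap_mul {G : LCLG.{u}} {f g : M → G} (hf : IsSmoothMap E G.model f)
    (hg : IsSmoothMap E G.model g) : IsSmoothMap E G.model (fun x => f x * g x) :=
  G.smooth_mul.comp (hf.prodMk hg)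

theorem isSmoothMap_inv {G : LCLG.{u}} {f : M → G} (hf : IsSmoothMap E G.model f) :
    IsSmoothMap E G.model (fun x => (f x)⁻¹) :=
  G.smooth_inv.comp hf

theorem isSmoothMap_smul {G F : LCLG.{u}} [LieGGroup G F] {f : M → G} {g : M → F}
    (hf : IsSmoothMap E G.model f) (hg : IsSmoothMap E F.model g) :
    IsSmoothMap E F.model (fun x => f x • g x) :=
  (LieGGroup.smooth_smul (G := G) (F := F)).comp (hf.prodMk hg)

theorem isSmoothMap_hom {G K : LCLG.{u}} (φ : G ⟶ K) {f : M → G}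
    (hf : IsSmoothMap E G.model f) : IsSmoothMap E K.model (fun x => φ (f x)) :=
  (Hom.smooth φ).comp hf

end

instance (G K : LCLG.{u}) : MonoidHomClass (Hom G K) G K where
  map_mul f := f.map_mul'
  map_one f := f.map_one'

/-- The morphism of `LCLG` given by a smooth group homomorphism. -/
def mkHom {G K : LCLG.{u}} (f : G →* K) (hf : IsSmoothMap G.model K.model f) : G ⟶ K :=
  (⟨f, hf⟩ : Hom G K)

/-- The action of `G` on `K` by conjugation through `f : G ⟶ K`, that is, `g • x = f g * x * (f g)⁻¹`.
-/
abbrev conjAction {G K : LCLG.{u}} (f : G ⟶ K) : LieGGroup G K where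
  smul g x := f g * x * (f g)⁻¹
  one_smul x := show f 1 * x * (f 1)⁻¹ = x by simp [map_one]
  mul_smul g h x := show f (g * h) * x * (f (g * h))⁻¹ = f g * (f h * x * (f h)⁻¹) * (f g)⁻¹ by
    simp [map_mul, mul_assoc]
  smul_mul g x y := show f g * (x * y) * (f g)⁻¹ = f g * x * (f g)⁻¹ * (f g * y * (f g)⁻¹) by
    simp [mul_assoc]
  smul_one g := show f g * 1 * (f g)⁻¹ = 1 by simp
  smooth_smul :=
    have h := isSmoothMap_hom f (IsSmoothMap.fst (F := K.model) (N := K) G.isSmoothAtlas)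
    isSmoothMap_mul (isSmoothMap_mul h (IsSmoothMap.snd K.isSmoothAtlas)) (isSmoothMap_inv h)

/-! ### Semidirect products -/

/-- The semidirect product `F ⋊ G` on the product manifold `F × G`; the group structure is
transported from Mathlib's `SemidirectProduct`. -/
def semidirect (G F : LCLG.{u}) [LieGGroup G F] : LCLG.{u} where
  carrier := F × G
  model := F.model × G.model
  group := (SemidirectProduct.equivProd (φ := MulDistribMulAction.toMulAut G F)).symm.group
  isSmoothAtlas := F.isSmoothAtlas.prod G.isSmoothAtlas
  smooth_mul := by
    have h := F.isSmoothAtlas.prod G.isSmoothAtlas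
    have h₁ := IsSmoothMap.fst (F := F.model × G.model) (N := F × G) h
    have h₂ := IsSmoothMap.snd (E := F.model × G.model) (M := F × G) h
    have hF := IsSmoothMap.fst (F := G.model) (N := G) F.isSmoothAtlas
    have hG := IsSmoothMap.snd (E := F.model) (M := F) G.isSmoothAtlas
    exact (isSmoothMap_mul (hF.comp h₁) (isSmoothMap_smul (hG.comp h₁) (hF.comp h₂))).prodMk
      (isSmoothMap_mul (hG.comp h₁) (hG.comp h₂))
  smooth_inv := by
    have hF := IsSmoothMap.fst (F := G.model) (N := G) F.isSmoothAtlas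
    have hG := IsSmoothMap.snd (E := F.model) (M := F) G.isSmoothAtlas
    exact (isSmoothMap_smul (isSmoothMap_inv hG) (isSmoothMap_inv hF)).prodMk (isSmoothMap_inv hG)

section

variable (G F : LCLG.{u}) [LieGGroup G F]

theorem semidirect_mul (a b : F) (g h : G) :
    (show semidirect G F from (a, g)) * (show semidirect G F from (b, h)) =
      (a * g • b, g * h) := rfl

/-- The embedding of `G` in `F ⋊ G`. -/
def semidirectInr : G ⟶ semidirect G F :=
  mkHom (K := semidirect G F)
    { toFun := fun g => ((1, g) : F × G)
      map_one' := rfl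
      map_mul' := fun g h => by
        rw [semidirect_mul, smul_one, mul_one] }
    ((IsSmoothMap.const 1).prodMk (IsSmoothMap.id _ G.isSmoothAtlas))

/-- An element of `F` commutes with the image of `g` in `F ⋊ G` precisely when `g` fixes it, so that
fixed points of the action of `G` are elements centralizing `G`. -/
theorem semidirectInr_mul_comm_iff (g : G) (x : F) :
    semidirectInr G F g * (show semidirect G F from (x, 1)) =
      (show semidirect G F from (x, 1)) * semidirectInr G F g ↔ g • x = x := by
  change (show semidirect G F from (1, g)) * _ = _ * (show semidirect G F from (1, g)) ↔ _
  rw [semidirect_mul, semidirect_mul, one_mul, mul_one, one_mul, smul_one, mul_one]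
  exact Prod.mk_left_injective g |>.eq_iff

end

/-! ### The wreath product with the group of order two -/

/-- The trivial action of `G` on `F`. -/
abbrev trivialAction (G F : LCLG.{u}) : LieGGroup G F where
  smul _ x := x
  one_smul _ := rfl
  mul_smul _ _ _ := rfl
  smul_mul _ _ _ := rfl
  smul_one _ := rfl
  smooth_smul := IsSmoothMap.snd F.isSmoothAtlas

/-- The direct product `F × G`, as the semidirect product for the trivial action. -/
def prod (F G : LCLG.{u}) : LCLG.{u} :=
  letI := trivialAction G F
  semidirect G F

/-- The discrete group `{±1}` of order two, as a Lie group modelled on the zero space. It is lifted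
to the universe of the other Lie groups. -/
def signs : LCLG.{u} where
  carrier := ULift.{u} ℤˣ
  model := PUnit.{u + 1}
  continuousSMul := ⟨continuous_of_const fun _ _ => rfl⟩
  locallyConvexSpace := ⟨fun _ => Filter.hasBasis_self.2 fun s hs =>
    ⟨s, hs, Set.subsingleton_of_subsingleton.convex, subset_rfl⟩⟩
  chartedSpace := .ofDiscreteTopology
  isSmoothAtlas :=
    letI : ChartedSpace PUnit.{u + 1} (ULift.{u} ℤˣ) := .ofDiscreteTopology
    (IsSmoothMap.of_subsingleton_model continuous_id).2
  smooth_mul :=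
    letI : ChartedSpace PUnit.{u + 1} (ULift.{u} ℤˣ) := .ofDiscreteTopology
    .of_subsingleton_model continuous_of_discreteTopology
  smooth_inv :=
    letI : ChartedSpace PUnit.{u + 1} (ULift.{u} ℤˣ) := .ofDiscreteTopology
    .of_subsingleton_model continuous_of_discreteTopology

instance : DiscreteTopology signs.{u} := inferInstanceAs (DiscreteTopology (ULift.{u} ℤˣ))

/-- The action of the group of order two on `K × K` by interchanging the factors. -/
abbrev swapAction (K : LCLG.{u}) : LieGGroup signs.{u} (prod K K) where
  smul s p := if s.down = 1 then p else Prod.swap p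
  one_smul _ := rfl
  mul_smul := by
    rintro ⟨s⟩ ⟨t⟩ p
    rcases Int.units_eq_one_or s with rfl | rfl <;> rcases Int.units_eq_one_or t with rfl | rfl <;>
      rfl
  smul_mul := by
    rintro ⟨s⟩ p q
    rcases Int.units_eq_one_or s with rfl | rfl <;> rfl
  smul_one := by
    rintro ⟨s⟩
    rcases Int.units_eq_one_or s with rfl | rfl <;> rfl
  smooth_smul := by
    -- The group acting is discrete, so locally the action is the identity or the interchange.
    have h₁ := IsSmoothMap.fst (F := K.model) (N := K) K.isSmoothAtlas
    have h₂ := IsSmoothMap.snd (E := K.model) (M := K) K.isSmoothAtlas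
    have h := IsSmoothMap.snd (E := signs.{u}.model) (M := signs.{u}) (prod K K).isSmoothAtlas
    refine IsSmoothMap.of_locally fun p => ⟨Prod.fst ⁻¹' {p.1},
      (isOpen_discrete _).preimage continuous_fst, rfl, ?_⟩
    obtain ⟨⟨s⟩, p⟩ := p
    rcases Int.units_eq_one_or s with rfl | rfl
    · refine ⟨_, h, ?_⟩
      rintro ⟨_, q⟩ rfl
      rfl
    · refine ⟨_, (h₂.prodMk h₁).comp h, ?_⟩
      rintro ⟨_, q⟩ rfl
      rfl

/-- The wreath product `(K × K) ⋊ {±1}`. -/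
def wreath (K : LCLG.{u}) : LCLG.{u} :=
  letI := swapAction K
  semidirect signs (prod K K)

/-- The morphism `g ↦ (f₁ g, f₂ g)` to the wreath product. -/
def wreathLift {G K : LCLG.{u}} (f₁ f₂ : G ⟶ K) : G ⟶ wreath K :=
  mkHom (K := wreath K)
    { toFun := fun g => (((f₁ g, f₂ g), 1) : (K × K) × signs.{u})
      map_one' := by
        rw [map_one, map_one]; rfl
      map_mul' := fun g h => by
        rw [map_mul, map_mul]; rfl }
    (((Hom.smooth f₁).prodMk (Hom.smooth f₂)).prodMk (IsSmoothMap.const 1))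

/-- The interchange of the two factors, as an element of the wreath product. -/
def wreathSwap (K : LCLG.{u}) : wreath K :=
  (((1, 1), ⟨-1⟩) : (K × K) × signs.{u})

/-- The interchange of the factors commutes with `(f₁ g, f₂ g)` precisely when its two components
agree, so that equality of morphisms becomes a statement about centralizers. -/
theorem wreathLift_mul_comm_iff {G K : LCLG.{u}} (f₁ f₂ : G ⟶ K) (g : G) :
    wreathLift f₁ f₂ g * wreathSwap K = wreathSwap K * wreathLift f₁ f₂ g ↔ f₁ g = f₂ g := by
  have h₁ : wreathLift f₁ f₂ g * wreathSwap K =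
      (((f₁ g * 1, f₂ g * 1), ⟨-1⟩) : (K × K) × signs.{u}) := rfl
  have h₂ : wreathSwap K * wreathLift f₁ f₂ g =
      (((1 * f₂ g, 1 * f₁ g), ⟨-1⟩) : (K × K) × signs.{u}) := rfl
  rw [h₁, h₂, mul_one, mul_one, one_mul, one_mul]
  constructor
  · intro h
    exact congrArg (fun p : (K × K) × signs.{u} => p.1.1) h
  · intro h
    rw [h]

/-- The inner automorphism `y ↦ x * y * x⁻¹` of `K`, as a morphism. -/
def conj (K : LCLG.{u}) (x : K) : K ⟶ K :=
  mkHom (MulAut.conj x).toMonoidHom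
    (isSmoothMap_mul (isSmoothMap_mul (IsSmoothMap.const x) (IsSmoothMap.id _ K.isSmoothAtlas))
      (IsSmoothMap.const x⁻¹))

end LCLG

/-! ### Epimorphisms -/

open LCLG in
theorem theorem2p2 {H G : LCLG.{u}} (i : H ⟶ G) :
    List.TFAE [
      Epi i,
      ∀ (K : LCLG.{u}) (f : G ⟶ K),
        Subgroup.centralizer (f '' range i) = Subgroup.centralizer (range f),
      ∀ (F : LCLG.{u}) [LCLG.LieGGroup G F] (x : F),
        (∀ h ∈ range i, h • x = x) → ∀ g : G, g • x = x] := by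
  tfae_have 1 → 2 := by
    intro hi K f
    refine le_antisymm (fun x hx => ?_) (Subgroup.centralizer_le (image_subset_range _ _))
    -- Conjugating by `x` does not change `f` on `i(H)`, hence not on `G`.
    have h : f ≫ conj K x = f := by
      rw [← cancel_epi i]
      refine ConcreteCategory.hom_ext _ _ fun y => ?_
      have := Subgroup.mem_centralizer_iff.1 hx (f (i y)) ⟨_, ⟨y, rfl⟩, rfl⟩
      exact mul_inv_eq_of_eq_mul this.symm
    rintro _ ⟨g, rfl⟩
    exact (mul_inv_eq_iff_eq_mul.1 (ConcreteCategory.congr_hom h g)).symm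
  -- Apply the hypothesis to the embedding of `G` in `F ⋊ G`.
  tfae_have 2 → 3 := by
    intro h F _ x hx g
    have hx' : (show semidirect G F from (x, 1)) ∈
        Subgroup.centralizer (semidirectInr G F '' range i) := by
      rintro _ ⟨g, hg, rfl⟩
      exact (semidirectInr_mul_comm_iff G F g x).2 (hx g hg)
    rw [h] at hx'
    exact (semidirectInr_mul_comm_iff G F g x).1 (hx' _ ⟨g, rfl⟩)
  tfae_have 3 → 2 := by
    intro h K f
    refine le_antisymm (fun x hx => ?_) (Subgroup.centralizer_le (image_subset_range _ _))
    let := conjAction f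
    rintro _ ⟨g, rfl⟩
    refine mul_inv_eq_iff_eq_mul.1 (h K x (fun g hg => ?_) g)
    exact mul_inv_eq_of_eq_mul (hx _ ⟨g, hg, rfl⟩)
  tfae_have 2 → 1 := by
    intro h
    refine ⟨fun {K} f₁ f₂ hf => ConcreteCategory.hom_ext _ _ fun g => ?_⟩
    have hs : wreathSwap K ∈ Subgroup.centralizer (wreathLift f₁ f₂ '' range i) := by
      rintro _ ⟨_, ⟨y, rfl⟩, rfl⟩
      exact (wreathLift_mul_comm_iff f₁ f₂ _).2 (ConcreteCategory.congr_hom hf y)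
    rw [h] at hs
    exact (wreathLift_mul_comm_iff f₁ f₂ g).1 (hs _ ⟨g, rfl⟩)
  tfae_finish
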